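/- Let $w = w_1w_2w_3\cdots$ be an infinite binary word, i.e. a sequence of letters $w_i\in\{0,1\}$. A factor of $w$ is a finite block $w_{i+1}\cdots w_{i+n}$ of consecutive letters. For $a\in\{0,1\}$ and $n\ge 0$ let $F^a_w(n)$ be the maximum number of letters $a$ in a factor of $w$ of length $n$. The prefix normal forms of $w$ are the infinite binary words $\mathrm{PNF}_1(w)$ and $\mathrm{PNF}_0(w)$ whose $n$-th letters ($n\ge 1$) are $F^1_w(n)-F^1_w(n-1)$ and $1-\bigl(F^0_w(n)-F^0_w(n-1)\bigr)$, respectively. Let $\max(w)$ (resp. $\min(w)$) be the infinite binary word whose prefix of length $n$ is, for every $n$, the lexicographically greatest (resp. smallest) factor of $w$ of length $n$, where $0<1$. Call $w$ characteristic Sturmian if it is the characteristic word of slope $\alpha$ for some irrational $\alpha\in[0,1]$, that is, if for some such $\alpha$ the word $0w$ (the letter $0$ followed by $w$) is the lower mechanical word with $n$-th letter $\lfloor\alpha n\rfloor-\lfloor\alpha(n-1)\rfloor$ and $1w$ is the upper mechanical word with $n$-th letter $\lceil\alpha n\rceil-\lceil\alpha(n-1)\rceil$, for all $n\ge1$. Then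 $w$ is characteristic Sturmian if and only if $$0w=\mathrm{PNF}_0(w)=\min(w)\quad\text{and}\quad 1w=\mathrm{PNF}_1(w)=\max(w).$$ -/

import Mathlib

namespace BinaryWord

/-- Infinite binary words over the ordered alphabet `{0 < 1}`. The letter `w_i` of the usual
notation `w = w_1 w_2 w_3 ⋯` is `w (i - 1)`: positions start at `0` here. -/
abbrev InfWord : Type := ℕ → Fin 2

/-- The infinite word `a w`: the letter `a` followed by `w`. -/
def cons (a : Fin 2) (w : InfWord) : InfWord
  | 0 => a
  | n + 1 => w n

/-- The block of length `n` of `w` that starts at position `i`. -/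
def block (w : InfWord) (i n : ℕ) : List (Fin 2) :=
  List.ofFn fun j : Fin n => w (i + j)

/-- The prefix of length `n` of `w`. -/
def pref (w : InfWord) (n : ℕ) : List (Fin 2) := block w 0 n

/-- The set of factors of length `n` of `w`. -/
def factors (w : InfWord) (n : ℕ) : Set (List (Fin 2)) :=
  {u | ∃ i, u = block w i n}

/-- `maxCount a w n` is the maximum number of letters `a` in a factor of length `n` of `w`
(see `maxCount_isGreatest`: the maximum exists). -/
noncomputable def maxCount (a : Fin 2) (w : InfWord) (n : ℕ) : ℕ :=
  sSup {k | ∃ u ∈ factors w n, k = u.count a}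

theorem length_block (w : InfWord) (i n : ℕ) : (block w i n).length = n := by
  simp [block]

theorem block_succ (w : InfWord) (i n : ℕ) :
    block w i (n + 1) = block w i n ++ [w (i + n)] := by
  rw [block, List.ofFn_succ', List.concat_eq_append]
  rfl

theorem factors_nonempty (w : InfWord) (n : ℕ) : (factors w n).Nonempty :=
  ⟨block w 0 n, 0, rfl⟩

theorem factors_finite (w : InfWord) (n : ℕ) : (factors w n).Finite := by
  refine (List.finite_length_eq (Fin 2) n).subset ?_
  rintro u ⟨i, rfl⟩
  exact length_block w i n

theorem maxCount_isGreatest (a : Fin 2) (w : InfWord) (n : ℕ) :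
    IsGreatest {k | ∃ u ∈ factors w n, k = u.count a} (maxCount a w n) := by
  have hb : BddAbove {k | ∃ u ∈ factors w n, k = u.count a} := by
    refine ⟨n, ?_⟩
    rintro k ⟨u, ⟨i, rfl⟩, rfl⟩
    exact List.count_le_length.trans (length_block w i n).le
  refine ⟨Nat.sSup_mem ?_ hb, fun k hk => le_csSup hb hk⟩
  exact ⟨_, block w 0 n, ⟨0, rfl⟩, rfl⟩

theorem maxCount_le_succ (a : Fin 2) (w : InfWord) (n : ℕ) : maxCount a w n ≤ maxCount a w (n + 1) := by
  obtain ⟨u, ⟨i, rfl⟩, h⟩ := (maxCount_isGreatest a w n).1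
  have h2 := (maxCount_isGreatest a w (n + 1)).2 ⟨block w i (n + 1), ⟨i, rfl⟩, rfl⟩
  rw [block_succ, List.count_append] at h2
  omega

theorem maxCount_succ_le (a : Fin 2) (w : InfWord) (n : ℕ) : maxCount a w (n + 1) ≤ maxCount a w n + 1 := by
  obtain ⟨u, ⟨i, rfl⟩, h⟩ := (maxCount_isGreatest a w (n + 1)).1
  have h2 := (maxCount_isGreatest a w n).2 ⟨block w i n, ⟨i, rfl⟩, rfl⟩
  have h3 : List.count a [w (i + n)] ≤ 1 := List.count_le_length
  rw [block_succ, List.count_append] at h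
  omega

/-- The letter `maxCount a w (n + 1) - maxCount a w n`; this first difference is `0` or `1`. -/
noncomputable def diffMaxCount (a : Fin 2) (w : InfWord) (n : ℕ) : Fin 2 :=
  ⟨maxCount a w (n + 1) - maxCount a w n, by have := maxCount_succ_le a w n; omega⟩

/-- The prefix normal form of `w` with respect to `1`. -/
noncomputable def PNF₁ (w : InfWord) : InfWord := fun n => diffMaxCount 1 w n

/-- The prefix normal form of `w` with respect to `0`, the complement `1 - x` of the
first differences of `maxCount 0 w`. -/
noncomputable def PNF₀ (w : InfWord) : InfWord := fun n => 1 - diffMaxCount 0 w n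

theorem append_lt_append {u v : List (Fin 2)} (hl : u.length = v.length) (h : u < v)
    (x y : List (Fin 2)) : u ++ x < v ++ y := by
  induction u generalizing v with
  | nil =>
    cases v with
    | nil => exact absurd h (lt_irrefl _)
    | cons b v => simp at hl
  | cons a u ih =>
    cases v with
    | nil => simp at hl
    | cons b v =>
      simp only [List.length_cons, Nat.add_right_cancel_iff] at hl
      simp only [List.cons_append, List.cons_lt_cons_iff] at h ⊢
      rcases h with h | ⟨h1, h2⟩
      · exact Or.inl h
      · exact Or.inr ⟨h1, ih hl h2⟩

/-- Two sequences of blocks: if every `g n` is a factor of length `n` and each is the beginning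
of the next one, they are the prefixes of one infinite word. -/
theorem exists_word_of_chain (w : InfWord) (g : ℕ → ℕ)
    (h : ∀ n, block w (g (n + 1)) n = block w (g n) n) :
    ∃ m : InfWord, ∀ n, pref m n = block w (g n) n := by
  refine ⟨fun n => w (g (n + 1) + n), fun n => ?_⟩
  induction n with
  | zero => simp [pref, block]
  | succ n ih =>
    rw [pref, block_succ, block_succ, h n, ← ih, pref, Nat.zero_add]

theorem exists_max (w : InfWord) :
    ∃ m : InfWord, ∀ n, IsGreatest (factors w n) (pref m n) := by
  have H : ∀ n, ∃ i, IsGreatest (factors w n) (block w i n) := by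
    intro n
    obtain ⟨u, hu⟩ := (factors_finite w n).exists_maximal (factors_nonempty w n)
    obtain ⟨i, rfl⟩ := hu.1
    exact ⟨i, hu.1, fun v hv => (le_total v (block w i n)).elim id fun h => hu.2 hv h⟩
  choose g hg using H
  obtain ⟨m, hm⟩ := exists_word_of_chain w g (fun n => by
    refine le_antisymm ((hg n).2 ⟨_, rfl⟩) (not_lt.1 fun hlt => ?_)
    have h1 := append_lt_append (by simp [length_block]) hlt
      [w (g (n + 1) + n)] [w (g n + n)]
    rw [← block_succ, ← block_succ] at h1
    exact absurd h1 (not_lt.2 ((hg (n + 1)).2 ⟨_, rfl⟩)))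
  exact ⟨m, fun n => hm n ▸ hg n⟩

theorem exists_min (w : InfWord) :
    ∃ m : InfWord, ∀ n, IsLeast (factors w n) (pref m n) := by
  have H : ∀ n, ∃ i, IsLeast (factors w n) (block w i n) := by
    intro n
    obtain ⟨u, hu⟩ := (factors_finite w n).exists_minimal (factors_nonempty w n)
    obtain ⟨i, rfl⟩ := hu.1
    exact ⟨i, hu.1, fun v hv => (le_total (block w i n) v).elim id fun h => hu.2 hv h⟩
  choose g hg using H
  obtain ⟨m, hm⟩ := exists_word_of_chain w g (fun n => by
    refine le_antisymm (not_lt.1 fun hlt => ?_) ((hg n).2 ⟨_, rfl⟩)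
    have h1 := append_lt_append (by simp [length_block]) hlt
      [w (g n + n)] [w (g (n + 1) + n)]
    rw [← block_succ, ← block_succ] at h1
    exact absurd h1 (not_lt.2 ((hg (n + 1)).2 ⟨_, rfl⟩)))
  exact ⟨m, fun n => hm n ▸ hg n⟩

/-- `max(w)`: the (unique) infinite word whose prefix of each length `n` is the lexicographically
greatest factor of length `n` of `w`. The order
on lists is the lexicographic one. -/
noncomputable def maxWord (w : InfWord) : InfWord := Classical.choose (exists_max w)

/-- `min(w)`: the (unique) infinite word whose prefix of each length `n` is the lexicographically
smallest factor of length `n` of `w`. -/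
noncomputable def minWord (w : InfWord) : InfWord := Classical.choose (exists_min w)

theorem maxWord_spec (w : InfWord) (n : ℕ) : IsGreatest (factors w n) (pref (maxWord w) n) :=
  Classical.choose_spec (exists_max w) n

theorem minWord_spec (w : InfWord) (n : ℕ) : IsLeast (factors w n) (pref (minWord w) n) :=
  Classical.choose_spec (exists_min w) n

theorem eq_of_pref_eq {m m' : InfWord} (h : ∀ n, pref m n = pref m' n) : m = m' := by
  funext n
  have := h (n + 1)
  rw [pref, pref, block_succ, block_succ] at this
  simpa using (List.append_inj' this rfl).2

theorem eq_maxWord_iff (w m : InfWord) :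
    m = maxWord w ↔ ∀ n, IsGreatest (factors w n) (pref m n) :=
  ⟨fun h => h ▸ maxWord_spec w,
    fun h => eq_of_pref_eq fun n => (h n).unique (maxWord_spec w n)⟩

theorem eq_minWord_iff (w m : InfWord) :
    m = minWord w ↔ ∀ n, IsLeast (factors w n) (pref m n) :=
  ⟨fun h => h ▸ minWord_spec w,
    fun h => eq_of_pref_eq fun n => (h n).unique (minWord_spec w n)⟩

/-- The lower mechanical word of slope `α` and intercept `τ`, as an integer sequence; the
value at `n` is the letter in position `n + 1` counted from `1`. -/
noncomputable def lowerMechanical (α τ : ℝ) (n : ℕ) : ℤ :=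
  ⌊α * (n + 1) + τ⌋ - ⌊α * n + τ⌋

/-- The upper mechanical word of slope `α` and intercept `τ`, as an integer sequence. -/
noncomputable def upperMechanical (α τ : ℝ) (n : ℕ) : ℤ :=
  ⌈α * (n + 1) + τ⌉ - ⌈α * n + τ⌉

/-- `w` is the characteristic word of slope `α`: the lower and the upper mechanical words of
slope `α` and intercept `0` are `0w` and `1w`. -/
def IsCharacteristicWord (α : ℝ) (w : InfWord) : Prop :=
  (∀ n, lowerMechanical α 0 n = ((cons 0 w n : ℕ) : ℤ)) ∧
  (∀ n, upperMechanical α 0 n = ((cons 1 w n : ℕ) : ℤ))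

/-- For irrational `α` between `0` and `1` the characteristic word of slope `α` exists and
is unique. -/
theorem existsUnique_isCharacteristicWord {α : ℝ} (h0 : 0 ≤ α) (h1 : α ≤ 1)
    (hα : Irrational α) : ∃! w, IsCharacteristicWord α w := by
  have h0' : 0 < α := lt_of_le_of_ne h0 hα.ne_zero.symm
  have h1' : α < 1 := lt_of_le_of_ne h1 hα.ne_one
  have hceil : ∀ n : ℕ, ⌈α * ((n : ℝ) + 1)⌉ = ⌊α * ((n : ℝ) + 1)⌋ + 1 := by
    intro n
    have hir : Irrational (α * ((n + 1 : ℕ) : ℝ)) := hα.mul_natCast n.succ_ne_zero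
    push_cast at hir
    rw [Int.ceil_eq_iff]
    push_cast
    have hne : (⌊α * ((n : ℝ) + 1)⌋ : ℝ) ≠ α * ((n : ℝ) + 1) := fun h => hir.ne_int _ h.symm
    have := lt_of_le_of_ne (Int.floor_le (α * ((n : ℝ) + 1))) hne
    have := Int.lt_floor_add_one (α * ((n : ℝ) + 1))
    constructor <;> linarith
  have hd : ∀ x : ℝ, 0 ≤ ⌊x + α⌋ - ⌊x⌋ ∧ ⌊x + α⌋ - ⌊x⌋ < 2 := by
    intro x
    have a1 : ⌊x⌋ ≤ ⌊x + α⌋ := Int.floor_le_floor (by linarith)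
    have a2 : ⌊x + α⌋ ≤ ⌊x + 1⌋ := Int.floor_le_floor (by linarith)
    rw [Int.floor_add_one] at a2
    omega
  have hf : ⌊α⌋ = 0 := Int.floor_eq_zero_iff.2 ⟨h0, h1'⟩
  refine ⟨fun n => ⟨(⌊α * ((n : ℝ) + 1) + α⌋ - ⌊α * ((n : ℝ) + 1)⌋).toNat, ?_⟩,
    ⟨fun n => ?_, fun n => ?_⟩, fun v hv => ?_⟩
  · have := hd (α * ((n : ℝ) + 1))
    omega
  · cases n with
    | zero => simp [lowerMechanical, cons, hf]
    | succ n =>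
      have := hd (α * ((n : ℝ) + 1))
      have e : α * ((n : ℝ) + 1 + 1) = α * ((n : ℝ) + 1) + α := by ring
      simp only [lowerMechanical, cons, add_zero]
      push_cast
      rw [e]
      omega
  · cases n with
    | zero =>
      have := hceil 0
      simp only [Nat.cast_zero, zero_add, mul_one, hf] at this
      simp [upperMechanical, cons, this]
    | succ n =>
      have := hd (α * ((n : ℝ) + 1))
      have e : α * ((n : ℝ) + 1 + 1) = α * ((n : ℝ) + 1) + α := by ring
      have c1 := hceil n
      have c2 := hceil (n + 1)
      simp only [upperMechanical, cons, add_zero]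
      push_cast at c2 ⊢
      rw [c1, c2, e]
      omega
  · funext n
    have := hd (α * ((n : ℝ) + 1))
    have e : α * ((n : ℝ) + 1 + 1) = α * ((n : ℝ) + 1) + α := by ring
    have h := hv.1 (n + 1)
    simp only [lowerMechanical, cons, add_zero] at h
    push_cast at h
    rw [e] at h
    apply Fin.ext
    simp only
    omega

/-- `w` is characteristic Sturmian: it is the characteristic word of some irrational slope. -/
def IsCharacteristicSturmian (w : InfWord) : Prop :=
  ∃ α : ℝ, 0 ≤ α ∧ α ≤ 1 ∧ Irrational α ∧ IsCharacteristicWord α w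

end BinaryWord

/-!
Write `h n` for the number of ones in the prefix of length `n` of `0w`. A factor of length `n` of
`w` has `h (i + n) - h i` ones for some `i > 0`, and the prefix of length `n > 0` of `1w` has
`h n + 1` ones. Hence `0w = PNF₀ w` and `1w = PNF₁ w` say that the defect `h (i + n) - h i - h n`
takes only the values `0` and `1`, and takes both for every `n > 0`. The first half makes `h`
superadditive and `h + 1` subadditive, so that `h n ≤ α n ≤ h n + 1` for some `α`; the second half
makes both inequalities strict, so `α` is irrational and `h n = ⌊α n⌋`.

Conversely, if `h n = ⌊α n⌋` with `α` irrational, then `⌊x⌋ + ⌊y⌋ ≤ ⌊x + y⌋ ≤ ⌊x⌋ + ⌈y⌉` bounds the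
ones in every factor. Since the fractional parts of the multiples of `α` come arbitrarily close to
`0` and to `1`, for every `N` either bound is attained, for all `y = α k` with `k ≤ N` at once, at a
single `x = α i`. So the prefixes of `0w` and `1w` are factors of `w`, and since a block with fewer
ones in each prefix is lexicographically smaller, they are the extreme factors.
-/

theorem exists_pos_fract_mul_natCast_mem_Ioo {α : ℝ} (hα : Irrational α) {a b : ℝ} (ha : 0 ≤ a)
    (hab : a < b) (hb : b ≤ 1) : ∃ i : ℕ, 0 < i ∧ Int.fract (α * i) ∈ Set.Ioo a b := by
  have hdense : DenseRange (· • (α : AddCircle (1 : ℝ)) : ℕ → AddCircle (1 : ℝ)) :=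
    denseRange_zsmul_iff_nsmul.1 (AddCircle.denseRange_zsmul_coe_iff.2 (by rwa [div_one]))
  obtain ⟨i, x, hx, hxi⟩ := hdense.exists_mem_open
    (QuotientAddGroup.isOpenMap_coe _ isOpen_Ioo) ((Set.nonempty_Ioo.2 hab).image _)
  have hfract : Int.fract (α * i) = x := by
    rw [← AddCircle.coe_eq_coe_iff_of_mem_Ico (p := 1) (a := 0)
      ⟨Int.fract_nonneg _, by simpa using Int.fract_lt_one _⟩ (by grind),
      AddCircle.coe_fract, mul_comm, ← nsmul_eq_mul, AddCircle.coe_nsmul]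
    exact hxi.symm
  refine ⟨i, Nat.pos_of_ne_zero ?_, hfract ▸ hx⟩
  rintro rfl
  simp only [Nat.cast_zero, mul_zero, Int.fract_zero] at hfract
  exact (ha.trans_lt hx.1).ne hfract

theorem exists_pos_forall_floor_mul_add_eq_add_floor {α : ℝ} (hα : Irrational α) {s : Set ℝ}
    (hs : s.Finite) : ∃ i : ℕ, 0 < i ∧ ∀ x ∈ s, ⌊α * i + x⌋ = ⌊α * i⌋ + ⌊x⌋ := by
  obtain ⟨y, -, hy⟩ := (insert (0 : ℝ) s).exists_max_image Int.fract (hs.insert 0) ⟨0, by simp⟩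
  obtain ⟨i, hi, -, hlt⟩ := exists_pos_fract_mul_natCast_mem_Ioo hα le_rfl
    (sub_pos.2 (Int.fract_lt_one y)) (sub_le_self 1 (Int.fract_nonneg y))
  refine ⟨i, hi, fun x hx => Int.floor_eq_iff.2 ?_⟩
  have hxy := hy x (Set.mem_insert_of_mem 0 hx)
  have := Int.fract_nonneg x
  have := Int.fract_nonneg (α * i)
  push_cast
  constructor <;> linarith [Int.floor_add_fract x, Int.floor_add_fract (α * i)]

theorem exists_pos_forall_floor_mul_add_eq_add_ceil {α : ℝ} (hα : Irrational α) {s : Set ℝ}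
    (hs : s.Finite) : ∃ i : ℕ, 0 < i ∧ ∀ x ∈ s, ⌊α * i + x⌋ = ⌊α * i⌋ + ⌈x⌉ := by
  obtain ⟨y, -, hy⟩ := (insert (0 : ℝ) s).exists_max_image (fun x => Int.fract (-x))
    (hs.insert 0) ⟨0, by simp⟩
  obtain ⟨i, hi, hlt, -⟩ := exists_pos_fract_mul_natCast_mem_Ioo hα (Int.fract_nonneg (-y))
    (Int.fract_lt_one (-y)) le_rfl
  refine ⟨i, hi, fun x hx => Int.floor_eq_iff.2 ?_⟩
  have hxy := hy x (Set.mem_insert_of_mem 0 hx)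
  have := Int.fract_nonneg (-x)
  have := Int.fract_lt_one (α * i)
  have hceil : (⌈x⌉ : ℝ) = x + Int.fract (-x) := by
    rw [← Int.self_sub_floor, Int.floor_neg]
    push_cast
    ring
  push_cast
  constructor <;> linarith [Int.floor_add_fract (α * i)]

theorem subadditive_apply_mul_le {u : ℕ → ℝ} (hu : Subadditive u) {k : ℕ} (hk : 0 < k) (n : ℕ) :
    u (k * n) ≤ k * u n := by
  obtain ⟨k, rfl⟩ := Nat.exists_eq_add_one.2 hk
  have := hu.apply_mul_add_le k n n
  rw [← Nat.succ_mul] at this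
  push_cast
  linarith

theorem exists_forall_mul_mem_Icc_of_subadditive {g h : ℕ → ℝ} (hg : Subadditive fun n => -g n)
    (hh : Subadditive h) (hgh : ∀ n, g n ≤ h n) :
    ∃ α : ℝ, ∀ n : ℕ, α * n ∈ Set.Icc (g n) (h n) := by
  have hdiv : ∀ x ∈ (fun n : ℕ => g n / n) '' Set.Ioi 0,
      ∀ y ∈ (fun n : ℕ => h n / n) '' Set.Ioi 0, x ≤ y := by
    rintro _ ⟨a, ha, rfl⟩ _ ⟨b, hb, rfl⟩
    rw [Set.mem_Ioi] at ha hb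
    rw [div_le_div_iff₀ (by positivity) (by positivity)]
    have hga := subadditive_apply_mul_le hg hb a
    have hhb := subadditive_apply_mul_le hh ha b
    have := hgh (a * b)
    rw [mul_comm b a] at hga
    linarith
  obtain ⟨α, hα, hα'⟩ := exists_between_of_forall_le (Set.nonempty_Ioi.image _)
    (Set.nonempty_Ioi.image _) hdiv
  refine ⟨α, fun n => ?_⟩
  rcases n.eq_zero_or_pos with rfl | hn
  · have hg0 := hg 0 0
    have hh0 := hh 0 0
    constructor <;> simp only [add_zero, Nat.cast_zero, mul_zero] at * <;> linarith
  · exact ⟨(div_le_iff₀ (by positivity)).1 (hα ⟨n, hn, rfl⟩),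
      (le_div_iff₀ (by positivity)).1 (hα' ⟨n, hn, rfl⟩)⟩

theorem irrational_of_forall_mul_mem_Ioo {α : ℝ} {f : ℕ → ℤ}
    (h : ∀ n : ℕ, 0 < n → α * n ∈ Set.Ioo (f n : ℝ) (f n + 1)) : Irrational α := by
  rintro ⟨q, rfl⟩
  obtain ⟨hlt, hgt⟩ := h q.den q.pos
  have hnum : (q : ℝ) * q.den = q.num := by exact_mod_cast q.mul_den_eq_num
  rw [hnum] at hlt hgt
  norm_cast at hlt hgt
  lia

theorem exists_forall_mul_mem_Ioo_of_add_defect {f : ℕ → ℤ}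
    (hle : ∀ i n, f i + f n ≤ f (i + n)) (hge : ∀ i n, f (i + n) ≤ f i + f n + 1)
    (hlow : ∀ n, 0 < n → ∃ i, 0 < i ∧ f (i + n) = f i + f n)
    (hupp : ∀ n, 0 < n → ∃ i, 0 < i ∧ f (i + n) = f i + f n + 1) :
    ∃ α : ℝ, ∀ n : ℕ, 0 < n → α * n ∈ Set.Ioo (f n : ℝ) (f n + 1) := by
  have hneg : Subadditive fun n => -(f n : ℝ) := fun i n => by
    have : (f i + f n : ℝ) ≤ f (i + n) := mod_cast hle i n
    linarith
  have hsucc : Subadditive fun n => (f n + 1 : ℝ) := fun i n => by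
    have : (f (i + n) : ℝ) ≤ f i + f n + 1 := mod_cast hge i n
    linarith
  obtain ⟨α, hα⟩ := exists_forall_mul_mem_Icc_of_subadditive hneg hsucc
    fun n => (lt_add_one _).le
  -- Equality on one side persists along multiples, so at `a * b` both sides would be equalities.
  have hexcl (a b : ℕ) (ha : 0 < a) (hb : 0 < b) (hfa : α * a ≤ f a) (hfb : f b + 1 ≤ α * b) :
      False := by
    have hfab : b * f a ≤ (f (a * b) : ℝ) := by
      have := subadditive_apply_mul_le hneg hb a
      rw [mul_comm b a] at this
      linarith
    have hfab' : (f (a * b) + 1 : ℝ) ≤ a * (f b + 1) := subadditive_apply_mul_le hsucc ha b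
    have hα_le : α * a * b ≤ f a * b := by gcongr
    have hα_ge : (f b + 1) * a ≤ α * b * a := by gcongr
    linarith
  refine ⟨α, fun n hn => ⟨not_le.1 fun hn' => ?_, not_le.1 fun hn' => ?_⟩⟩
  · obtain ⟨i, hi, hin⟩ := hupp n hn
    have hin' : (f (i + n) : ℝ) = f i + f n + 1 := mod_cast hin
    have hle_mul := (hα (i + n)).1
    push_cast at hle_mul
    exact hexcl n i hn hi hn' (by linarith)
  · obtain ⟨i, hi, hin⟩ := hlow n hn
    have hin' : (f (i + n) : ℝ) = f i + f n := mod_cast hin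
    have hmul_le := (hα (i + n)).2
    push_cast at hmul_le
    exact hexcl i n hi hn (by linarith) hn'

namespace BinaryWord

theorem block_add (w : InfWord) (i m n : ℕ) :
    block w i (m + n) = block w i m ++ block w (i + m) n := by
  induction n with
  | zero => simp [block]
  | succ n ih => rw [← add_assoc, block_succ, block_succ, ih, List.append_assoc, add_assoc]

theorem block_cons (a : Fin 2) (w : InfWord) (i n : ℕ) :
    block (cons a w) (i + 1) n = block w i n := by
  simp only [block, Nat.add_right_comm i 1, cons]

theorem count_zero_block_add_count_one_block (w : InfWord) (i n : ℕ) :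
    (block w i n).count 0 + (block w i n).count 1 = n := by
  have hcount (l : List (Fin 2)) : l.count 0 + l.count 1 = l.length := by
    induction l with
    | nil => rfl
    | cons a l ih => fin_cases a <;> simp <;> lia
  rw [hcount, length_block]

/-- The number of letters `1` in the prefix of length `n` of `w`. It determines `w`, and its
increments count the letters `1` of the blocks of `w`. -/
def prefixOnes (w : InfWord) (n : ℕ) : ℕ := (pref w n).count 1

@[simp]
theorem prefixOnes_zero (w : InfWord) : prefixOnes w 0 = 0 := by
  simp [prefixOnes, pref, block]

theorem prefixOnes_add (w : InfWord) (i n : ℕ) :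
    prefixOnes w (i + n) = prefixOnes w i + (block w i n).count 1 := by
  rw [prefixOnes, pref, block_add, List.count_append, zero_add, prefixOnes, pref]

theorem prefixOnes_succ (w : InfWord) (n : ℕ) :
    prefixOnes w (n + 1) = prefixOnes w n + w n := by
  have hcount : ∀ a : Fin 2, [a].count 1 = (a : ℕ) := by decide
  rw [prefixOnes_add, ← hcount (w n)]
  simp [block]

theorem prefixOnes_cons_add (a : Fin 2) (w : InfWord) (i n : ℕ) :
    prefixOnes (cons a w) (i + 1 + n) = prefixOnes (cons a w) (i + 1) + (block w i n).count 1 := by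
  rw [prefixOnes_add, block_cons]

theorem prefixOnes_cons_succ (a : Fin 2) (w : InfWord) (n : ℕ) :
    prefixOnes (cons a w) (n + 1) = a + prefixOnes w n := by
  rw [add_comm n, ← zero_add 1, prefixOnes_cons_add, prefixOnes_succ, prefixOnes_zero, zero_add]
  rfl

theorem forall_sub_eq_iff_forall_eq_prefixOnes {F : ℕ → ℤ} (hF : F 0 = 0) (v : InfWord) :
    (∀ n, F (n + 1) - F n = (v n : ℕ)) ↔ ∀ n, F n = prefixOnes v n := by
  refine ⟨fun h n => ?_, fun h n => by rw [h, h, prefixOnes_succ]; push_cast; ring⟩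
  induction n with
  | zero => simpa using hF
  | succ n ih => rw [prefixOnes_succ, Nat.cast_add, ← h n, ← ih, add_sub_cancel]

theorem maxCount_zero (a : Fin 2) (w : InfWord) : maxCount a w 0 = 0 := by
  obtain ⟨_, ⟨i, rfl⟩, h⟩ := (maxCount_isGreatest a w 0).1
  simpa [block] using h

theorem isGreatest_maxCount (a : Fin 2) (w : InfWord) (n : ℕ) :
    IsGreatest (Set.range fun i => (block w i n).count a) (maxCount a w n) := by
  convert maxCount_isGreatest a w n using 1
  ext k
  constructor
  · rintro ⟨i, rfl⟩
    exact ⟨_, ⟨i, rfl⟩, rfl⟩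
  · rintro ⟨_, ⟨i, rfl⟩, rfl⟩
    exact ⟨i, rfl⟩

theorem isLeast_count_one_iff {w : InfWord} {n k : ℕ} :
    IsLeast (Set.range fun i => (block w i n).count 1) k ↔ maxCount 0 w n + k = n := by
  have hcount (i : ℕ) := count_zero_block_add_count_one_block w i n
  obtain ⟨⟨i, hi⟩, hmax⟩ := isGreatest_maxCount 0 w n
  have hleast : IsLeast (Set.range fun i => (block w i n).count 1) ((block w i n).count 1) := by
    refine ⟨⟨i, rfl⟩, Set.forall_mem_range.2 fun j => ?_⟩
    have hij : (block w j n).count 0 ≤ (block w i n).count 0 := (hmax ⟨j, rfl⟩).trans_eq hi.symm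
    linarith [hcount i, hcount j]
  rw [hleast.isLeast_iff_eq, ← hi]
  have := hcount i
  lia

theorem eq_PNF₁_iff (v w : InfWord) :
    v = PNF₁ w ↔ ∀ n, IsGreatest (Set.range fun i => (block w i n).count 1) (prefixOnes v n) := by
  have hletter (n : ℕ) : v n = PNF₁ w n ↔
      (maxCount 1 w (n + 1) : ℤ) - maxCount 1 w n = (v n : ℕ) := by
    have := maxCount_le_succ 1 w n
    rw [Fin.ext_iff]
    simp only [PNF₁, diffMaxCount]
    lia
  rw [funext_iff, forall_congr' hletter,
    forall_sub_eq_iff_forall_eq_prefixOnes (F := fun n => maxCount 1 w n) (by simp [maxCount_zero])]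
  simp only [Nat.cast_inj, (isGreatest_maxCount 1 w _).isGreatest_iff_eq]

theorem eq_PNF₀_iff (v w : InfWord) :
    v = PNF₀ w ↔ ∀ n, IsLeast (Set.range fun i => (block w i n).count 1) (prefixOnes v n) := by
  have hletter (n : ℕ) : v n = PNF₀ w n ↔
      ((n + 1 : ℕ) - maxCount 0 w (n + 1) : ℤ) - (n - maxCount 0 w n) = (v n : ℕ) := by
    have := maxCount_le_succ 0 w n
    have hcompl : ∀ a b : Fin 2, a = 1 - b ↔ (a : ℕ) + b = 1 := by decide
    rw [PNF₀, hcompl]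
    simp only [diffMaxCount]
    lia
  rw [funext_iff, forall_congr' hletter, forall_sub_eq_iff_forall_eq_prefixOnes
    (F := fun n => n - maxCount 0 w n) (by simp [maxCount_zero])]
  refine forall_congr' fun n => ?_
  rw [isLeast_count_one_iff]
  lia

theorem block_le_block_of_count_one_le {v w : InfWord} {i j n : ℕ}
    (h : ∀ k ≤ n, (block v i k).count 1 ≤ (block w j k).count 1) :
    block v i n ≤ block w j n := by
  induction n with
  | zero => simp [block]
  | succ n ih =>
    rcases (ih fun k hk => h k (by lia)).lt_or_eq with hlt | heq
    · rw [block_succ, block_succ]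
      exact (append_lt_append (by simp only [length_block]) hlt _ _).le
    · have hlast : ∀ a b : Fin 2, [a].count 1 ≤ [b].count 1 → a ≤ b := by decide
      have hcount := h (n + 1) le_rfl
      rw [block_succ, block_succ, heq, List.count_append, List.count_append,
        Nat.add_le_add_iff_left] at hcount
      rw [block_succ, block_succ, heq]
      rcases (hlast _ _ hcount).lt_or_eq with hlt | heq
      · exact (List.append_left_lt (List.cons_lt_cons_iff.2 (.inl hlt))).le
      · rw [heq]

theorem pref_mem_factors_of_count_one_eq {v w : InfWord} {i n : ℕ}
    (h : ∀ k ≤ n, (block w i k).count 1 = prefixOnes v k) : pref v n ∈ factors w n :=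
  ⟨i, le_antisymm (block_le_block_of_count_one_le fun k hk => (h k hk).ge)
    (block_le_block_of_count_one_le fun k hk => (h k hk).le)⟩

theorem eq_PNF₁_of_forall_count_one_le {v w : InfWord} (hmem : ∀ n, pref v n ∈ factors w n)
    (hle : ∀ n i, (block w i n).count 1 ≤ prefixOnes v n) : v = PNF₁ w :=
  (eq_PNF₁_iff v w).2 fun n =>
    ⟨(hmem n).imp fun _ hi => by rw [prefixOnes, hi], Set.forall_mem_range.2 (hle n)⟩

theorem eq_PNF₀_of_forall_le_count_one {v w : InfWord} (hmem : ∀ n, pref v n ∈ factors w n)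
    (hle : ∀ n i, prefixOnes v n ≤ (block w i n).count 1) : v = PNF₀ w :=
  (eq_PNF₀_iff v w).2 fun n =>
    ⟨(hmem n).imp fun _ hi => by rw [prefixOnes, hi], Set.forall_mem_range.2 (hle n)⟩

theorem PNF₁_eq_maxWord {w : InfWord} (hmem : ∀ n, pref (PNF₁ w) n ∈ factors w n) :
    PNF₁ w = maxWord w := by
  rw [eq_maxWord_iff]
  refine fun n => ⟨hmem n, ?_⟩
  rintro _ ⟨i, rfl⟩
  exact block_le_block_of_count_one_le fun k _ => ((eq_PNF₁_iff _ w).1 rfl k).2 ⟨i, rfl⟩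

theorem PNF₀_eq_minWord {w : InfWord} (hmem : ∀ n, pref (PNF₀ w) n ∈ factors w n) :
    PNF₀ w = minWord w := by
  rw [eq_minWord_iff]
  refine fun n => ⟨hmem n, ?_⟩
  rintro _ ⟨i, rfl⟩
  exact block_le_block_of_count_one_le fun k _ => ((eq_PNF₀_iff _ w).1 rfl k).2 ⟨i, rfl⟩

theorem prefixOnes_cons_one {w : InfWord} {n : ℕ} (hn : 0 < n) :
    prefixOnes (cons 1 w) n = prefixOnes (cons 0 w) n + 1 := by
  obtain ⟨n, rfl⟩ := Nat.exists_eq_add_one.2 hn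
  rw [prefixOnes_cons_succ, prefixOnes_cons_succ, Fin.val_zero, Fin.val_one, zero_add, add_comm]

theorem isCharacteristicWord_iff {α : ℝ} {w : InfWord} :
    IsCharacteristicWord α w ↔
      (∀ n : ℕ, ⌊α * n⌋ = prefixOnes (cons 0 w) n) ∧
        ∀ n : ℕ, ⌈α * n⌉ = prefixOnes (cons 1 w) n := by
  rw [← forall_sub_eq_iff_forall_eq_prefixOnes (F := fun n => ⌊α * n⌋) (by simp),
    ← forall_sub_eq_iff_forall_eq_prefixOnes (F := fun n => ⌈α * n⌉) (by simp)]
  simp only [IsCharacteristicWord, lowerMechanical, upperMechanical, add_zero, Nat.cast_succ]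

theorem isCharacteristicWord_of_mul_mem_Ioo {α : ℝ} {w : InfWord}
    (h : ∀ n : ℕ, 0 < n →
      α * n ∈ Set.Ioo (prefixOnes (cons 0 w) n : ℝ) (prefixOnes (cons 0 w) n + 1)) :
    IsCharacteristicWord α w := by
  refine isCharacteristicWord_iff.2 ⟨fun n => ?_, fun n => ?_⟩ <;>
    rcases n.eq_zero_or_pos with rfl | hn
  · simp
  · exact Int.floor_eq_iff.2 ⟨mod_cast (h n hn).1.le, mod_cast (h n hn).2⟩
  · simp
  · rw [prefixOnes_cons_one hn]
    refine Int.ceil_eq_iff.2 ⟨?_, mod_cast (h n hn).2.le⟩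
    push_cast
    linarith [(h n hn).1]

theorem exists_forall_mul_mem_Ioo_prefixOnes {w : InfWord} (h₀ : cons 0 w = PNF₀ w)
    (h₁ : cons 1 w = PNF₁ w) :
    ∃ α : ℝ, ∀ n : ℕ, 0 < n →
      α * n ∈ Set.Ioo (prefixOnes (cons 0 w) n : ℝ) (prefixOnes (cons 0 w) n + 1) := by
  rw [eq_PNF₀_iff] at h₀
  rw [eq_PNF₁_iff] at h₁
  have hadd := prefixOnes_cons_add 0 w
  have hupp {n : ℕ} (hn : 0 < n) := prefixOnes_cons_one (w := w) hn
  refine exists_forall_mul_mem_Ioo_of_add_defect (f := fun n => prefixOnes (cons 0 w) n) ?_ ?_ ?_ ?_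
  · rintro (_ | i) n
    · simp
    · have := (h₀ n).2 ⟨i, rfl⟩
      grind
  · rintro (_ | i) n
    · simp
    · rcases n.eq_zero_or_pos with rfl | hn
      · simp
      · have := (h₁ n).2 ⟨i, rfl⟩
        grind
  · intro n _
    obtain ⟨i, hi⟩ := (h₀ n).1
    exact ⟨i + 1, i.succ_pos, by grind⟩
  · intro n hn
    obtain ⟨i, hi⟩ := (h₁ n).1
    exact ⟨i + 1, i.succ_pos, by grind⟩

theorem isCharacteristicSturmian_of_eq_PNF {w : InfWord} (h₀ : cons 0 w = PNF₀ w)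
    (h₁ : cons 1 w = PNF₁ w) : IsCharacteristicSturmian w := by
  obtain ⟨α, hα⟩ := exists_forall_mul_mem_Ioo_prefixOnes h₀ h₁
  obtain ⟨hpos, hlt⟩ : α ∈ Set.Ioo 0 1 := by
    simpa [prefixOnes_cons_succ] using hα 1 one_pos
  have hirr : Irrational α :=
    irrational_of_forall_mul_mem_Ioo (f := fun n => prefixOnes (cons 0 w) n) (mod_cast hα)
  exact ⟨α, hpos.le, hlt.le, hirr, isCharacteristicWord_of_mul_mem_Ioo hα⟩

namespace IsCharacteristicWord

variable {α : ℝ} {w : InfWord}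

theorem floor_mul_add (h : IsCharacteristicWord α w) (i n : ℕ) :
    ⌊α * (i + 1 : ℕ) + α * n⌋ = ⌊α * (i + 1 : ℕ)⌋ + (block w i n).count 1 := by
  rw [← mul_add, ← Nat.cast_add, (isCharacteristicWord_iff.1 h).1, (isCharacteristicWord_iff.1 h).1,
    prefixOnes_cons_add, Nat.cast_add]

theorem prefixOnes_cons_zero_le (h : IsCharacteristicWord α w) (n i : ℕ) :
    prefixOnes (cons 0 w) n ≤ (block w i n).count 1 := by
  have hfloor := Int.le_floor_add (α * (i + 1 : ℕ)) (α * n)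
  rw [h.floor_mul_add, (isCharacteristicWord_iff.1 h).1 n] at hfloor
  lia

theorem le_prefixOnes_cons_one (h : IsCharacteristicWord α w) (n i : ℕ) :
    (block w i n).count 1 ≤ prefixOnes (cons 1 w) n := by
  have hceil : ⌊α * (i + 1 : ℕ) + α * n⌋ ≤ ⌊α * (i + 1 : ℕ)⌋ + ⌈α * n⌉ := by
    rw [← Int.floor_add_intCast]
    exact Int.floor_le_floor (by gcongr; exact Int.le_ceil _)
  rw [h.floor_mul_add, (isCharacteristicWord_iff.1 h).2 n] at hceil
  lia

theorem pref_cons_zero_mem_factors (h : IsCharacteristicWord α w) (hα : Irrational α) (n : ℕ) :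
    pref (cons 0 w) n ∈ factors w n := by
  obtain ⟨_ | i, hi, hfloor⟩ := exists_pos_forall_floor_mul_add_eq_add_floor hα
    ((Set.finite_Iic n).image fun k : ℕ => α * k)
  · exact absurd hi (lt_irrefl 0)
  refine pref_mem_factors_of_count_one_eq (i := i) fun k hk => ?_
  have := hfloor _ (Set.mem_image_of_mem _ hk)
  rw [h.floor_mul_add, (isCharacteristicWord_iff.1 h).1 k] at this
  lia

theorem pref_cons_one_mem_factors (h : IsCharacteristicWord α w) (hα : Irrational α) (n : ℕ) :
    pref (cons 1 w) n ∈ factors w n := by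
  obtain ⟨_ | i, hi, hceil⟩ := exists_pos_forall_floor_mul_add_eq_add_ceil hα
    ((Set.finite_Iic n).image fun k : ℕ => α * k)
  · exact absurd hi (lt_irrefl 0)
  refine pref_mem_factors_of_count_one_eq (i := i) fun k hk => ?_
  have := hceil _ (Set.mem_image_of_mem _ hk)
  rw [h.floor_mul_add, (isCharacteristicWord_iff.1 h).2 k] at this
  lia

end IsCharacteristicWord

end BinaryWord

theorem corollary4 (w : BinaryWord.InfWord) :
    BinaryWord.IsCharacteristicSturmian w ↔
      (BinaryWord.cons 0 w = BinaryWord.PNF₀ w ∧ BinaryWord.PNF₀ w = BinaryWord.minWord w) ∧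
      (BinaryWord.cons 1 w = BinaryWord.PNF₁ w ∧ BinaryWord.PNF₁ w = BinaryWord.maxWord w) := by
  constructor
  · rintro ⟨α, -, -, hα, h⟩
    have hmem₀ := h.pref_cons_zero_mem_factors hα
    have hmem₁ := h.pref_cons_one_mem_factors hα
    have hPNF₀ := BinaryWord.eq_PNF₀_of_forall_le_count_one hmem₀ h.prefixOnes_cons_zero_le
    have hPNF₁ := BinaryWord.eq_PNF₁_of_forall_count_one_le hmem₁ h.le_prefixOnes_cons_one
    exact ⟨⟨hPNF₀, BinaryWord.PNF₀_eq_minWord (hPNF₀ ▸ hmem₀)⟩,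
      hPNF₁, BinaryWord.PNF₁_eq_maxWord (hPNF₁ ▸ hmem₁)⟩
  · rintro ⟨⟨hPNF₀, -⟩, hPNF₁, -⟩
    exact BinaryWord.isCharacteristicSturmian_of_eq_PNF hPNF₀ hPNF₁
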